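/- Let $n\ge 3$ and let $A,B$ be real symmetric $n\times n$ matrices that are hypomorphic: for every $i\in\{1,\dots,n\}$, the matrix $B_i$ obtained from $B$ by deleting the $i$-th row and column arises from the corresponding matrix $A_i$ by some simultaneous permutation of rows and columns. Let $\mathbf 1=(1,\dots,1)^t\in\mathbb R^n$. For a real symmetric $n\times n$ matrix $C$, a diagonal matrix $D=\mathrm{diag}(\lambda_1\ge\cdots\ge\lambda_n)$, an orthogonal matrix $Q=(\mathbf q_1,\dots,\mathbf q_n)$ and a set $S\subseteq\{1,\dots,n\}$, call $C=QDQ^t$ a decomposition adapted to $S$ if $(\mathbf 1,\mathbf q_i)\ne 0$ for $i\in S$, $(\mathbf 1,\mathbf q_i)=0$ for $i\notin S$, and $|S|$ is the number of distinct eigenvalues of $C$ whose eigenspace is not orthogonal to $\mathbf 1$. 1. There exist a set $S\subseteq\{1,\dots,n\}$, a diagonal matrix $D$ and orthogonal matrices $P=(\mathbf p_1,\dots,\mathbf p_n)$, $U=(\mathbf u_1,\dots,\mathbf u_n)$ such that $A=PDP^t$ and $B=UDU^t$ are both decompositions adapted to $S$ and $\mathbf p_i=\mathbf u_i$ or $\mathbf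 p_i=-\mathbf u_i$ for every $i\in S$. 2. Moreover, whenever $A=PDP^t$ and $B=UDU^t$ (with the same $D$) are decompositions adapted to the same set $S$, we have $\mathbf p_i=\mathbf u_i$ or $\mathbf p_i=-\mathbf u_i$ for every $i\in S$. 3. In particular, if $\lambda$ is a simple eigenvalue of $A$ whose eigenspace is not orthogonal to $\mathbf 1$, then the $\lambda$-eigenspaces of $A$ and $B$ coincide. -/

import Mathlib

/-- The principal submatrix `A_i`: delete the `i`-th row and the `i`-th column of `A`. -/
def deleteRowCol {n : ℕ} (A : Matrix (Fin n) (Fin n) ℝ) (i : Fin n) :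
    Matrix {j : Fin n // j ≠ i} {j : Fin n // j ≠ i} ℝ :=
  A.submatrix Subtype.val Subtype.val

/-- `A` and `B` are hypomorphic: for every `i`, `B_i` is obtained from `A_i` by a simultaneous
permutation (depending on `i`) of rows and columns. -/
def Hypomorphic {n : ℕ} (A B : Matrix (Fin n) (Fin n) ℝ) : Prop :=
  ∀ i : Fin n, ∃ σ : Equiv.Perm {j : Fin n // j ≠ i},
    deleteRowCol B i = (deleteRowCol A i).submatrix σ σ

/-- The eigenspace of `A` for `μ` (zero if `μ` is not an eigenvalue). -/
noncomputable def eigenspaceOf {n : ℕ} (A : Matrix (Fin n) (Fin n) ℝ) (μ : ℝ) :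
    Submodule ℝ (Fin n → ℝ) :=
  Module.End.eigenspace (Matrix.toLin' A) μ

/-- The set of the eigenvalues of `A` whose eigenspace is not orthogonal to `x`. -/
def mainEigenvalues {n : ℕ} (A : Matrix (Fin n) (Fin n) ℝ) (x : Fin n → ℝ) : Set ℝ :=
  {μ | ∃ v ∈ eigenspaceOf A μ, x ⬝ᵥ v ≠ 0}

/-- `A = P D Pᵀ` with `P` orthogonal and `D = diag(d₁ ≥ ⋯ ≥ dₙ)`, where the columns of `P` not
orthogonal to `x` are exactly those indexed by `S`, and `S` has as many elements as `A` has distinct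
eigenvalues with eigenspace not orthogonal to `x`. -/
structure IsAdaptedDecomposition {n : ℕ} (A : Matrix (Fin n) (Fin n) ℝ) (x : Fin n → ℝ)
    (d : Fin n → ℝ) (P : Matrix (Fin n) (Fin n) ℝ) (S : Finset (Fin n)) : Prop where
  antitone : Antitone d
  orthogonal : P ∈ Matrix.orthogonalGroup (Fin n) ℝ
  eq_mul : A = P * Matrix.diagonal d * P.transpose
  card_eq : S.card = (mainEigenvalues A x).ncard
  mem : ∀ i ∈ S, x ⬝ᵥ P.col i ≠ 0
  not_mem : ∀ i, i ∉ S → x ⬝ᵥ P.col i = 0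

open Matrix Polynomial

namespace Matrix

/-- The derivative of the characteristic polynomial is the trace of the adjugate of the
characteristic matrix. -/
theorem derivative_charpoly_eq_sum_adjugate {R m : Type*} [CommRing R] [Fintype m] [DecidableEq m]
    (A : Matrix m m R) :
    derivative A.charpoly = ∑ i, A.charmatrix.adjugate i i := by
  have hder : ∀ i j, derivative (A.charmatrix i j) = (1 : Matrix m m R[X]) i j := by
    intro i j
    by_cases h : i = j
    · subst h; simp [charmatrix_apply_eq]
    · simp [h]
  have hadj : ∀ i, A.charmatrix.adjugate i i = (A.charmatrix.updateCol i (Pi.single i 1)).det := by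
    intro i
    rw [← cramer_apply, cramer_eq_adjugate_mulVec]
    simp
  simp_rw [hadj, charpoly, det_apply, Polynomial.derivative_sum]
  rw [Finset.sum_comm]
  refine Finset.sum_congr rfl fun σ _ => ?_
  rw [Units.smul_def, Polynomial.derivative_smul, Polynomial.derivative_prod_finset, Finset.smul_sum]
  refine Finset.sum_congr rfl fun i _ => ?_
  rw [Units.smul_def, ← Finset.mul_prod_erase Finset.univ _ (Finset.mem_univ i), mul_comm]
  congr 2
  · rw [hder]; simp [one_apply, Pi.single_apply]
  · refine Finset.prod_congr rfl fun j hj => ?_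
    rw [updateCol_ne (Finset.ne_of_mem_erase hj)]

section AllOnes

variable {R m : Type*} [CommRing R] [Fintype m]

theorem of_one_mulVec (w : m → R) :
    (of fun _ _ => 1 : Matrix m m R) *ᵥ w = (1 ⬝ᵥ w) • 1 := by
  ext i; simp [mulVec, dotProduct]

variable [DecidableEq m]

theorem adjugate_add_of_one_mulVec (N : Matrix m m R) :
    (N + of fun _ _ => 1).adjugate *ᵥ 1 = N.adjugate *ᵥ 1 := by
  rw [← cramer_eq_adjugate_mulVec, ← cramer_eq_adjugate_mulVec]
  ext i
  rw [cramer_apply, cramer_apply, ← det_transpose, ← det_transpose (N.updateCol i 1)]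
  refine det_eq_of_forall_row_eq_smul_add_const (fun j => if j = i then 0 else 1) i (by simp) ?_
  intro j k
  by_cases h : j = i
  · subst h; simp
  · simp [h]

theorem det_add_of_one (N : Matrix m m R) :
    (N + of fun _ _ => 1).det = N.det + 1 ⬝ᵥ (N.adjugate *ᵥ 1) := by
  cases isEmpty_or_nonempty m with
  | inl h => simp [dotProduct]
  | inr h =>
    have h1 : (N + of fun _ _ => 1) *ᵥ (N.adjugate *ᵥ 1) = (N + of fun _ _ => 1).det • 1 := by
      rw [← adjugate_add_of_one_mulVec, mulVec_mulVec, mul_adjugate, smul_mulVec, one_mulVec]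
    rw [add_mulVec, of_one_mulVec, mulVec_mulVec, mul_adjugate, smul_mulVec, one_mulVec] at h1
    simpa using (congrFun h1 (Classical.arbitrary m)).symm

theorem sq_adjugate_mulVec_one {N : Matrix m m R} (hN : N.IsSymm) (i : m) :
    (N.adjugate *ᵥ 1) i ^ 2 =
      N.adjugate i i * (N + of fun _ _ => 1).det - (N + of fun _ _ => 1).adjugate i i * N.det := by
  have h : N.adjugate * (of fun _ _ => 1) * (N + of fun _ _ => 1).adjugate =
      (N + of fun _ _ => 1).det • N.adjugate - N.det • (N + of fun _ _ => 1).adjugate := by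
    have h1 : N.adjugate * (N + of fun _ _ => 1) * (N + of fun _ _ => 1).adjugate =
      (N + of fun _ _ => 1).det • N.adjugate := by
      rw [mul_assoc, mul_adjugate, mul_smul_comm, mul_one]
    have h2 : N.adjugate * N * (N + of fun _ _ => 1).adjugate =
      N.det • (N + of fun _ _ => 1).adjugate := by
      rw [adjugate_mul, smul_mul_assoc, one_mul]
    rw [← h1, ← h2, mul_add, add_mul, add_sub_cancel_left]
  have hs : (N + of fun _ _ => 1).adjugate.IsSymm := by
    refine IsSymm.adjugate (hN.add ?_)
    ext; simp
  have h' := congrFun (congrFun h i) i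
  simp only [sub_apply, smul_apply, smul_eq_mul] at h'
  rw [mul_comm _ (det _), mul_comm _ N.det, ← h', pow_two]
  nth_rewrite 2 [← adjugate_add_of_one_mulVec]
  simp only [mul_apply, mulVec, dotProduct, of_apply, Pi.one_apply, mul_one]
  rw [← Finset.mul_sum]
  congr 1
  exact Finset.sum_congr rfl fun j _ => hs.apply _ _

end AllOnes

end Matrix

namespace Matrix

theorem charmatrix_sub_of_one {R m : Type*} [CommRing R] [Fintype m] [DecidableEq m]
    (A : Matrix m m R) :
    (A - of fun _ _ => 1).charmatrix = A.charmatrix + of fun _ _ => 1 := by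
  ext i j : 2
  simp only [charmatrix_apply, sub_apply, of_apply, add_apply, C_sub, C_1,
    sub_sub_eq_add_sub, sub_add_eq_add_sub]

theorem adjugate_charmatrix_apply_self {n : ℕ} (A : Matrix (Fin n) (Fin n) ℝ) (i : Fin n) :
    A.charmatrix.adjugate i i = (deleteRowCol A i).charpoly := by
  cases n with
  | zero => exact i.elim0
  | succ n =>
    rw [adjugate_fin_succ_eq_det_submatrix, Even.neg_one_pow ⟨_, rfl⟩, one_mul, charpoly,
      ← det_submatrix_equiv_self (finSuccAboveEquiv i)]
    congr 1
    ext j k : 2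
    have hsucc : ∀ l, ((finSuccAboveEquiv i l : {j // j ≠ i}) : Fin (n + 1)) = i.succAbove l :=
      fun l => rfl
    simp [charmatrix_apply, deleteRowCol, diagonal_apply, hsucc]

section CoeffVec

variable {R m : Type*} [CommRing R] [Fintype m] [DecidableEq m]

/-- The polynomial vector `adj(X - A) 𝟏`. -/
noncomputable def adjugateOnes (A : Matrix m m R) : m → R[X] :=
  A.charmatrix.adjugate *ᵥ 1

theorem X_mul_adjugateOnes (A : Matrix m m R) (i : m) :
    X * A.adjugateOnes i = ∑ j, C (A i j) * A.adjugateOnes j + A.charpoly := by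
  have h : A.charmatrix *ᵥ A.adjugateOnes = A.charpoly • 1 := by
    rw [adjugateOnes, mulVec_mulVec, mul_adjugate, smul_mulVec, one_mulVec, charpoly]
  have h' := congrFun h i
  simp only [mulVec, dotProduct, charmatrix_apply, sub_mul, Finset.sum_sub_distrib,
    diagonal_apply, ite_mul, zero_mul, Finset.sum_ite_eq, Finset.mem_univ, if_true,
    Pi.smul_apply, Pi.one_apply, smul_eq_mul, mul_one] at h'
  rw [← h']; ring

/-- The vector of the coefficients at `X ^ k` of `adj(X - A) 𝟏`. -/
noncomputable def adjugateOnesCoeff (A : Matrix m m R) (k : ℕ) : m → R :=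
  fun i => (A.adjugateOnes i).coeff k

theorem adjugateOnesCoeff_eq (A : Matrix m m R) (k : ℕ) :
    A.adjugateOnesCoeff k = A *ᵥ A.adjugateOnesCoeff (k + 1) + A.charpoly.coeff (k + 1) • 1 := by
  ext i
  have h := congrArg (fun p => p.coeff (k + 1)) (X_mul_adjugateOnes A i)
  simpa [coeff_X_mul, finsetSum_coeff, mulVec, dotProduct, adjugateOnesCoeff] using h

theorem mulVec_adjugateOnesCoeff_zero (A : Matrix m m R) :
    A *ᵥ A.adjugateOnesCoeff 0 = -A.charpoly.coeff 0 • 1 := by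
  ext i
  have h := congrArg (fun p => p.coeff 0) (X_mul_adjugateOnes A i)
  simp only [coeff_X_mul_zero, coeff_add, finsetSum_coeff, coeff_C_mul] at h
  simp only [mulVec, dotProduct, adjugateOnesCoeff, Pi.smul_apply, Pi.one_apply, smul_eq_mul,
    mul_one]
  exact eq_neg_of_add_eq_zero_left h.symm

theorem adjugateOnesCoeff_eq_zero [Nontrivial R] (A : Matrix m m R) {k : ℕ}
    (hk : Fintype.card m ≤ k) : A.adjugateOnesCoeff k = 0 := by
  obtain ⟨M, hM⟩ : ∃ M : ℕ, ∀ k, M ≤ k → A.adjugateOnesCoeff k = 0 := by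
    refine ⟨Finset.univ.sup (fun i => (A.adjugateOnes i).natDegree) + 1, fun k hk => ?_⟩
    ext i
    refine coeff_eq_zero_of_natDegree_lt ?_
    have := Finset.le_sup (f := fun i => (A.adjugateOnes i).natDegree) (Finset.mem_univ i)
    omega
  have key : ∀ r k, Fintype.card m ≤ k → M ≤ k + r → A.adjugateOnesCoeff k = 0 := by
    intro r
    induction r with
    | zero => exact fun k _ h => hM k h
    | succ r ih =>
      intro k h1 h2
      rw [adjugateOnesCoeff_eq, ih (k + 1) (by omega) (by omega), coeff_eq_zero_of_natDegree_lt]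
      · simp
      · rw [charpoly_natDegree_eq_dim]; omega
  exact key M k hk (by omega)

theorem adjugateOnesCoeff_card_sub_one [Nontrivial R] (A : Matrix m m R)
    (h : 0 < Fintype.card m) : A.adjugateOnesCoeff (Fintype.card m - 1) = 1 := by
  rw [adjugateOnesCoeff_eq, Nat.sub_add_cancel h, adjugateOnesCoeff_eq_zero A le_rfl]
  have := A.charpoly_monic
  rw [Monic, leadingCoeff, charpoly_natDegree_eq_dim] at this
  simp [this]

theorem charpoly_sub_of_one (A : Matrix m m R) :
    (A - of fun _ _ => 1).charpoly = A.charpoly + ∑ i, A.adjugateOnes i := by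
  rw [charpoly, charmatrix_sub_of_one, det_add_of_one]
  simp [charpoly, adjugateOnes, dotProduct]

end CoeffVec

theorem adjugateOnes_sq {n : ℕ} {A : Matrix (Fin n) (Fin n) ℝ} (hA : A.IsSymm) (i : Fin n) :
    A.adjugateOnes i ^ 2 = (deleteRowCol A i).charpoly * (A - of fun _ _ => 1).charpoly -
      (deleteRowCol (A - of fun _ _ => 1) i).charpoly * A.charpoly := by
  have hs : A.charmatrix.IsSymm := by
    rw [IsSymm, ← charmatrix_transpose, hA]
  rw [adjugateOnes, sq_adjugate_mulVec_one hs, ← charmatrix_sub_of_one,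
    adjugate_charmatrix_apply_self, adjugate_charmatrix_apply_self, ← charpoly, ← charpoly]

end Matrix

namespace Hypomorphic

variable {n : ℕ} {A B : Matrix (Fin n) (Fin n) ℝ}

theorem sub_of_one (h : Hypomorphic A B) :
    Hypomorphic (A - of fun _ _ => 1) (B - of fun _ _ => 1) := by
  intro i
  obtain ⟨σ, hσ⟩ := h i
  refine ⟨σ, ?_⟩
  ext j k
  have := congrFun (congrFun hσ j) k
  simpa [deleteRowCol] using this

theorem charpoly_deleteRowCol_eq (h : Hypomorphic A B) (i : Fin n) :
    (deleteRowCol B i).charpoly = (deleteRowCol A i).charpoly := by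
  obtain ⟨σ, hσ⟩ := h i
  have h1 := charpoly_reindex σ.symm (deleteRowCol A i)
  rw [reindex_apply, Equiv.symm_symm] at h1
  rw [hσ, h1]

theorem exists_charpoly_eq_add_C (h : Hypomorphic A B) :
    ∃ c : ℝ, A.charpoly = B.charpoly + C c := by
  have hd : derivative (A.charpoly - B.charpoly) = 0 := by
    rw [derivative_sub, derivative_charpoly_eq_sum_adjugate, derivative_charpoly_eq_sum_adjugate,
      sub_eq_zero]
    refine Finset.sum_congr rfl fun i _ => ?_
    rw [adjugate_charmatrix_apply_self, adjugate_charmatrix_apply_self, h.charpoly_deleteRowCol_eq]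
  refine ⟨(A.charpoly - B.charpoly).coeff 0, ?_⟩
  rw [← eq_C_of_derivative_eq_zero hd]
  ring

theorem coeff_charpoly_deleteRowCol_sub (A : Matrix (Fin n) (Fin n) ℝ) (hn : 2 ≤ n) (i : Fin n) :
    (deleteRowCol (A - of fun _ _ => 1) i).charpoly.coeff (n - 2) -
      (deleteRowCol A i).charpoly.coeff (n - 2) = n - 1 := by
  have hc : Fintype.card {j : Fin n // j ≠ i} = n - 1 := by simp
  have : Nonempty {j : Fin n // j ≠ i} := Fintype.card_pos_iff.mp (by omega)
  have h1 := trace_eq_neg_charpoly_coeff (deleteRowCol A i)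
  have h2 := trace_eq_neg_charpoly_coeff (deleteRowCol (A - of fun _ _ => 1) i)
  rw [hc, show n - 1 - 1 = n - 2 by omega] at h1 h2
  have h3 : (deleteRowCol (A - of fun _ _ => 1) i).trace =
      (deleteRowCol A i).trace - ((n - 1 : ℕ) : ℝ) := by
    simp only [trace, diag_apply, deleteRowCol, submatrix_apply, Matrix.sub_apply, of_apply,
      Finset.sum_sub_distrib, Finset.sum_const, Finset.card_univ, hc, nsmul_eq_mul, mul_one]
  rw [Nat.cast_sub (by omega), Nat.cast_one] at h3
  linarith

/-- Hypomorphic symmetric matrices of size at least three have the same characteristic polynomial,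
and the vectors `adj(X - A) 𝟏` and `adj(X - B) 𝟏` agree. -/
theorem charpoly_eq_and_adjugateOnes_eq (hn : 3 ≤ n) (hA : A.IsSymm) (hB : B.IsSymm)
    (h : Hypomorphic A B) : A.charpoly = B.charpoly ∧ A.adjugateOnes = B.adjugateOnes := by
  obtain ⟨c, hc⟩ := h.exists_charpoly_eq_add_C
  obtain ⟨e, he⟩ := h.sub_of_one.exists_charpoly_eq_add_C
  have hsum : ∑ i, (A.adjugateOnes i - B.adjugateOnes i) = C (e - c) := by
    have h1 := A.charpoly_sub_of_one
    have h2 := B.charpoly_sub_of_one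
    rw [Finset.sum_sub_distrib, C_sub]
    linear_combination h2 - h1 + he - hc
  have hprod : ∀ i, (A.adjugateOnes i - B.adjugateOnes i) * (A.adjugateOnes i + B.adjugateOnes i) =
      C e * (deleteRowCol A i).charpoly - C c * (deleteRowCol (A - of fun _ _ => 1) i).charpoly := by
    intro i
    have h1 := adjugateOnes_sq hA i
    have h2 := adjugateOnes_sq hB i
    rw [h.charpoly_deleteRowCol_eq, h.sub_of_one.charpoly_deleteRowCol_eq] at h2
    rw [he, hc] at h1
    linear_combination h1 - h2
  have hdeg : ∀ (M : Matrix (Fin n) (Fin n) ℝ) i, (deleteRowCol M i).charpoly.natDegree = n - 1 := by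
    intro M i
    rw [charpoly_natDegree_eq_dim]; simp
  have hcoeff : ∀ (M : Matrix (Fin n) (Fin n) ℝ) i,
      (deleteRowCol M i).charpoly.coeff (n - 1) = 1 := by
    intro M i
    have := (deleteRowCol M i).charpoly_monic
    rwa [Monic, leadingCoeff, hdeg] at this
  have hvcoeff : ∀ (M : Matrix (Fin n) (Fin n) ℝ) i, (M.adjugateOnes i).coeff (n - 1) = 1 := by
    intro M i
    have := congrFun (M.adjugateOnesCoeff_card_sub_one (by simp; omega)) i
    simpa [adjugateOnesCoeff] using this
  have hplus : ∀ i, (A.adjugateOnes i + B.adjugateOnes i).coeff (n - 1) = 2 := by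
    intro i; rw [coeff_add, hvcoeff, hvcoeff]; norm_num
  have hplus0 : ∀ i, A.adjugateOnes i + B.adjugateOnes i ≠ 0 := by
    intro i h0
    have := hplus i
    rw [h0] at this
    norm_num at this
  have hconst : ∀ i, ∃ a, A.adjugateOnes i - B.adjugateOnes i = C a := by
    intro i
    by_cases h0 : A.adjugateOnes i - B.adjugateOnes i = 0
    · exact ⟨0, by simpa using h0⟩
    · refine ⟨_, eq_C_of_natDegree_eq_zero ?_⟩
      have h1 : n - 1 ≤ (A.adjugateOnes i + B.adjugateOnes i).natDegree := by
        apply le_natDegree_of_ne_zero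
        rw [hplus]; norm_num
      have h2 := natDegree_mul h0 (hplus0 i)
      have h3 : (C e * (deleteRowCol A i).charpoly -
          C c * (deleteRowCol (A - of fun _ _ => 1) i).charpoly).natDegree ≤ n - 1 := by
        refine (natDegree_sub_le _ _).trans (max_le ?_ ?_)
        · exact (natDegree_C_mul_le _ _).trans (hdeg _ _).le
        · exact (natDegree_C_mul_le _ _).trans (hdeg _ _).le
      rw [hprod] at h2
      omega
  have hval : ∀ i, A.adjugateOnes i - B.adjugateOnes i = C ((e - c) / 2) := by
    intro i
    obtain ⟨a, ha⟩ := hconst i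
    have h1 := congrArg (fun p => p.coeff (n - 1)) (hprod i)
    simp only [ha, coeff_C_mul, coeff_sub, hplus, hcoeff] at h1
    rw [ha]
    congr 1
    linarith
  have hec : e - c = 0 := by
    simp_rw [hval] at hsum
    rw [Finset.sum_const, Finset.card_univ, Fintype.card_fin, nsmul_eq_mul, ← C_eq_natCast,
      ← C_mul] at hsum
    have h1 := C_injective hsum
    have h3 : (3 : ℝ) ≤ n := by exact_mod_cast hn
    have h4 : (e - c) * ((n : ℝ) - 2) = 0 := by linarith
    rcases mul_eq_zero.mp h4 with h5 | h5
    · exact h5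
    · linarith
  have hv : A.adjugateOnes = B.adjugateOnes := by
    ext1 i
    rw [← sub_eq_zero, hval, hec]; simp
  refine ⟨?_, hv⟩
  let i : Fin n := ⟨0, by omega⟩
  have h1 := congrArg (fun p => p.coeff (n - 2)) (hprod i)
  have h2 := coeff_charpoly_deleteRowCol_sub A (by omega) i
  simp only [hv, sub_self, zero_mul, coeff_zero, coeff_sub, coeff_C_mul] at h1
  rw [sub_eq_zero.mp hec, ← mul_sub, zero_eq_mul] at h1
  have h3 : (3 : ℝ) ≤ n := by exact_mod_cast hn
  rcases h1 with h1 | h1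
  · rw [hc, h1]; simp
  · linarith

/-- Every polynomial in one of two hypomorphic symmetric matrices acts on the all-ones vector like
the same polynomial in the other. -/
theorem aeval_mulVec_one_eq (hn : 3 ≤ n) (hA : A.IsSymm) (hB : B.IsSymm)
    (h : Hypomorphic A B) (q : ℝ[X]) : aeval A q *ᵥ (1 : Fin n → ℝ) = aeval B q *ᵥ 1 := by
  obtain ⟨hp, hv⟩ := h.charpoly_eq_and_adjugateOnes_eq hn hA hB
  have hcv : ∀ k, A.adjugateOnesCoeff k = B.adjugateOnesCoeff k := by
    intro k; unfold adjugateOnesCoeff; rw [hv]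
  have hAB : ∀ k, A *ᵥ A.adjugateOnesCoeff k = B *ᵥ A.adjugateOnesCoeff k := by
    intro k
    cases k with
    | zero => rw [mulVec_adjugateOnesCoeff_zero, hcv, mulVec_adjugateOnesCoeff_zero, hp]
    | succ k =>
      have h1 := A.adjugateOnesCoeff_eq k
      rw [hcv k, B.adjugateOnesCoeff_eq k, hp, ← hcv] at h1
      exact (add_right_cancel h1).symm
  let W := Submodule.span ℝ (Set.range A.adjugateOnesCoeff)
  have h1W : (1 : Fin n → ℝ) ∈ W :=
    Submodule.subset_span ⟨_, A.adjugateOnesCoeff_card_sub_one (by simp; omega)⟩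
  have hW : ∀ w ∈ W, A *ᵥ w ∈ W ∧ A *ᵥ w = B *ᵥ w := by
    intro w hw
    induction hw using Submodule.span_induction with
    | mem x hx =>
      obtain ⟨k, rfl⟩ := hx
      refine ⟨?_, hAB k⟩
      cases k with
      | zero => rw [mulVec_adjugateOnesCoeff_zero]; exact W.smul_mem _ h1W
      | succ k =>
        rw [← sub_eq_of_eq_add (A.adjugateOnesCoeff_eq k)]
        exact W.sub_mem (Submodule.subset_span ⟨k, rfl⟩) (W.smul_mem _ h1W)
    | zero => simp
    | add x y _ _ hx hy =>
      rw [mulVec_add, mulVec_add, ← hx.2, ← hy.2]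
      exact ⟨W.add_mem hx.1 hy.1, rfl⟩
    | smul a x _ hx =>
      rw [mulVec_smul, mulVec_smul, ← hx.2]
      exact ⟨W.smul_mem _ hx.1, rfl⟩
  have hpow : ∀ k, A ^ k *ᵥ (1 : Fin n → ℝ) ∈ W ∧ A ^ k *ᵥ (1 : Fin n → ℝ) = B ^ k *ᵥ 1 := by
    intro k
    induction k with
    | zero => simpa using h1W
    | succ k ih =>
      rw [pow_succ', pow_succ', ← mulVec_mulVec, ← mulVec_mulVec, ← ih.2]
      exact hW _ ih.1
  induction q using Polynomial.induction_on' with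
  | add p q hp hq => rw [map_add, map_add, add_mulVec, add_mulVec, hp, hq]
  | monomial k a =>
    rw [aeval_monomial, aeval_monomial, ← Algebra.smul_def, ← Algebra.smul_def, smul_mulVec,
      smul_mulVec, (hpow k).2]

end Hypomorphic

theorem mem_eigenspaceOf_iff {n : ℕ} {A : Matrix (Fin n) (Fin n) ℝ} {μ : ℝ} {v : Fin n → ℝ} :
    v ∈ eigenspaceOf A μ ↔ A *ᵥ v = μ • v := by
  rw [eigenspaceOf, Module.End.mem_eigenspace_iff, toLin'_apply]

namespace Matrix

/-- `A = P D Pᵀ` with `P` orthogonal and `D = diag(d₁, …, dₙ)`. -/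
structure IsOrthogonalDiagonalization {n : ℕ} (A : Matrix (Fin n) (Fin n) ℝ) (d : Fin n → ℝ)
    (P : Matrix (Fin n) (Fin n) ℝ) : Prop where
  orthogonal : P ∈ orthogonalGroup (Fin n) ℝ
  eq_mul : A = P * diagonal d * Pᵀ

variable {n : ℕ} {A B P U : Matrix (Fin n) (Fin n) ℝ} {d : Fin n → ℝ}

theorem IsHermitian.exists_perm_antitone_eigenvalues (hA : A.IsHermitian) :
    ∃ τ : Equiv.Perm (Fin n), Antitone (hA.eigenvalues ∘ τ) := by
  refine ⟨Tuple.sort (fun i => -hA.eigenvalues i), fun i j hij => ?_⟩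
  exact neg_le_neg_iff.mp (Tuple.monotone_sort (fun i => -hA.eigenvalues i) hij)

theorem IsHermitian.exists_isOrthogonalDiagonalization (hA : A.IsHermitian)
    (τ : Equiv.Perm (Fin n)) :
    ∃ P, A.IsOrthogonalDiagonalization (hA.eigenvalues ∘ τ) P := by
  let V : Matrix (Fin n) (Fin n) ℝ := hA.eigenvectorUnitary
  have hV : V * Vᵀ = 1 := by
    have := mem_unitaryGroup_iff.mp hA.eigenvectorUnitary.2
    rwa [star_eq_conjTranspose, conjTranspose_eq_transpose_of_trivial] at this
  have hs : A = V * diagonal hA.eigenvalues * Vᵀ := by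
    have := hA.spectral_theorem
    rw [Unitary.conjStarAlgAut_apply, star_eq_conjTranspose,
      conjTranspose_eq_transpose_of_trivial] at this
    exact this
  refine ⟨V.submatrix id τ, ?_, ?_⟩
  · rw [mem_orthogonalGroup_iff, transpose_submatrix, submatrix_mul_equiv, hV, submatrix_id_id]
  · have hd : diagonal (hA.eigenvalues ∘ τ) = (diagonal hA.eigenvalues).submatrix τ τ :=
      (submatrix_diagonal_equiv _ τ).symm
    rw [hd, transpose_submatrix, submatrix_mul_equiv, submatrix_mul_equiv, submatrix_id_id]
    exact hs

namespace IsOrthogonalDiagonalization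

theorem mul_transpose (h : A.IsOrthogonalDiagonalization d P) : P * Pᵀ = 1 :=
  (mem_orthogonalGroup_iff _ _).mp h.orthogonal

theorem transpose_mul (h : A.IsOrthogonalDiagonalization d P) : Pᵀ * P = 1 :=
  mul_eq_one_comm.mp h.mul_transpose

theorem col_dotProduct_col (h : A.IsOrthogonalDiagonalization d P) (i j : Fin n) :
    P.col i ⬝ᵥ P.col j = if i = j then 1 else 0 := by
  have := congrFun (congrFun h.transpose_mul i) j
  rwa [one_apply] at this

theorem mulVec_col (h : A.IsOrthogonalDiagonalization d P) (i : Fin n) :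
    A *ᵥ P.col i = d i • P.col i := by
  have h1 : A * P = P * diagonal d := by
    rw [h.eq_mul, mul_assoc, h.transpose_mul, mul_one]
  ext j
  have := congrFun (congrFun h1 j) i
  rw [mul_diagonal, mul_comm] at this
  exact this

theorem isSymm (h : A.IsOrthogonalDiagonalization d P) : A.IsSymm := by
  rw [IsSymm, h.eq_mul, Matrix.transpose_mul, Matrix.transpose_mul, transpose_transpose,
    diagonal_transpose, mul_assoc]

theorem sum_col (h : A.IsOrthogonalDiagonalization d P) (x : Fin n → ℝ) :
    ∑ i, (P.col i ⬝ᵥ x) • P.col i = x := by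
  have h1 : P *ᵥ (Pᵀ *ᵥ x) = x := by
    rw [mulVec_mulVec, h.mul_transpose, one_mulVec]
  refine Eq.trans ?_ h1
  ext j
  simp [mulVec, dotProduct, mul_comm]

theorem aeval_mulVec (h : A.IsOrthogonalDiagonalization d P) (q : ℝ[X]) (x : Fin n → ℝ) :
    aeval A q *ᵥ x = ∑ i, (q.eval (d i) * (P.col i ⬝ᵥ x)) • P.col i := by
  have hcol : ∀ i, aeval A q *ᵥ P.col i = q.eval (d i) • P.col i := by
    intro i
    have hpow : ∀ k, A ^ k *ᵥ P.col i = d i ^ k • P.col i := by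
      intro k
      induction k with
      | zero => simp
      | succ k ih =>
        rw [pow_succ, ← mulVec_mulVec, h.mulVec_col, mulVec_smul, ih, smul_smul, pow_succ, mul_comm]
    induction q using Polynomial.induction_on' with
    | add p q hp hq => rw [map_add, add_mulVec, hp, hq, eval_add, add_smul]
    | monomial k a =>
      rw [aeval_monomial, ← Algebra.smul_def, smul_mulVec, hpow, eval_monomial, smul_smul]
  nth_rewrite 1 [← h.sum_col x]
  rw [mulVec_sum]
  refine Finset.sum_congr rfl fun i _ => ?_
  rw [mulVec_smul, hcol, smul_smul, mul_comm]

theorem col_dotProduct_eq_zero (h : A.IsOrthogonalDiagonalization d P) {μ : ℝ} {v : Fin n → ℝ}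
    (hv : v ∈ eigenspaceOf A μ) {i : Fin n} (hi : d i ≠ μ) : P.col i ⬝ᵥ v = 0 := by
  rw [mem_eigenspaceOf_iff] at hv
  have h1 : P.col i ⬝ᵥ (A *ᵥ v) = d i * (P.col i ⬝ᵥ v) := by
    rw [dotProduct_mulVec, ← mulVec_transpose, h.isSymm, h.mulVec_col, smul_dotProduct, smul_eq_mul]
  rw [hv, dotProduct_smul, smul_eq_mul] at h1
  have h2 : (d i - μ) * (P.col i ⬝ᵥ v) = 0 := by linarith
  exact (mul_eq_zero.mp h2).resolve_left (sub_ne_zero.mpr hi)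

theorem col_mem_eigenspaceOf (h : A.IsOrthogonalDiagonalization d P) (i : Fin n) :
    P.col i ∈ eigenspaceOf A (d i) :=
  mem_eigenspaceOf_iff.mpr (h.mulVec_col i)

theorem finrank_eigenspaceOf (h : A.IsOrthogonalDiagonalization d P) (μ : ℝ) :
    Module.finrank ℝ (eigenspaceOf A μ) = Fintype.card {i // d i = μ} := by
  have hspan : Submodule.span ℝ (Set.range fun i : {i // d i = μ} => P.col i) =
      eigenspaceOf A μ := by
    apply le_antisymm
    · rw [Submodule.span_le]
      rintro _ ⟨⟨i, rfl⟩, rfl⟩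
      exact h.col_mem_eigenspaceOf i
    · intro v hv
      rw [← h.sum_col v]
      refine Submodule.sum_mem _ fun i _ => ?_
      by_cases hi : d i = μ
      · exact Submodule.smul_mem _ _ (Submodule.subset_span ⟨⟨i, hi⟩, rfl⟩)
      · rw [h.col_dotProduct_eq_zero hv hi, zero_smul]
        exact Submodule.zero_mem _
  have hli : LinearIndependent ℝ P.col := by
    rw [linearIndependent_cols_iff_isUnit]
    exact IsUnit.of_mul_eq_one _ h.mul_transpose
  rw [← hspan]
  exact finrank_span_eq_card (hli.comp _ Subtype.val_injective)

/-- An orthonormal basis of an eigenspace can be chosen to contain a given unit vector. -/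
theorem exists_orthonormal_eigenvectors (h : A.IsOrthogonalDiagonalization d P)
    {S : Finset (Fin n)} (hS : Set.InjOn d S) {p : Fin n → Fin n → ℝ}
    (hp : ∀ i ∈ S, p i ∈ eigenspaceOf A (d i)) (hp1 : ∀ i ∈ S, p i ⬝ᵥ p i = 1) (μ : ℝ) :
    ∃ b : {i // d i = μ} → Fin n → ℝ, (∀ i, b i ∈ eigenspaceOf A μ) ∧
      (∀ i j, b i ⬝ᵥ b j = if i = j then 1 else 0) ∧ ∀ i, i.1 ∈ S → b i = p i := by
  classical
  let e := (WithLp.linearEquiv 2 ℝ (Fin n → ℝ)).symm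
  let E : Submodule ℝ (EuclideanSpace ℝ (Fin n)) := (eigenspaceOf A μ).map e.toLinearMap
  have hE : Module.finrank ℝ E = Fintype.card {i // d i = μ} := by
    rw [← h.finrank_eigenspaceOf μ]
    exact LinearEquiv.finrank_map_eq e _
  let s : Set {i // d i = μ} := {i | i.1 ∈ S}
  let v : {i // d i = μ} → E := fun i =>
    if hi : i.1 ∈ S then
      ⟨e (p i), Submodule.mem_map_of_mem (by have := hp i hi; rwa [i.2] at this)⟩ else 0
  have hvs : ∀ i ∈ s, ((v i : E) : EuclideanSpace ℝ (Fin n)) = e (p i) := by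
    intro i hi
    have : i.1 ∈ S := hi
    simp [v, this]
  have hs : Subsingleton s := by
    refine ⟨fun i j => ?_⟩
    exact Subtype.ext (Subtype.ext (hS i.2 j.2 (i.1.2.trans j.1.2.symm)))
  have hinner : ∀ x y : Fin n → ℝ, inner ℝ (e x) (e y) = x ⬝ᵥ y := by
    intro x y
    rw [EuclideanSpace.inner_eq_star_dotProduct, star_trivial, dotProduct_comm]
    rfl
  have hv : Orthonormal ℝ (s.domRestrict v) := by
    refine ⟨fun i => ?_, fun i j hij => absurd (Subsingleton.elim i j) hij⟩
    have h1 : ‖(v i : E)‖ ^ 2 = 1 := by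
      change ‖((v i : E) : EuclideanSpace ℝ (Fin n))‖ ^ 2 = 1
      rw [hvs _ i.2, ← real_inner_self_eq_norm_sq, hinner, hp1 _ i.2]
    have h2 : ‖(v i : E)‖ = 1 := by
      rwa [pow_eq_one_iff_of_nonneg (norm_nonneg _) two_ne_zero] at h1
    exact h2
  obtain ⟨b, hb⟩ := hv.exists_orthonormalBasis_extension_of_card_eq hE
  refine ⟨fun i => e.symm (b i), fun i => ?_, fun i j => ?_, fun i hi => ?_⟩
  · obtain ⟨x, hx, hxe⟩ := (b i).2
    have : e.symm (b i) = x := by rw [← hxe]; exact e.symm_apply_apply x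
    beta_reduce
    rw [this]; exact hx
  · rw [← hinner, e.apply_symm_apply, e.apply_symm_apply, ← Submodule.coe_inner]
    exact orthonormal_iff_ite.mp b.orthonormal i j
  · beta_reduce
    rw [hb i hi, hvs i hi, e.symm_apply_apply]

/-- A diagonalization with prescribed eigenvectors for some eigenvalues, one for each of them. -/
theorem exists_extension (h : A.IsOrthogonalDiagonalization d P)
    {S : Finset (Fin n)} (hS : Set.InjOn d S) {p : Fin n → Fin n → ℝ}
    (hp : ∀ i ∈ S, p i ∈ eigenspaceOf A (d i)) (hp1 : ∀ i ∈ S, p i ⬝ᵥ p i = 1) :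
    ∃ U, A.IsOrthogonalDiagonalization d U ∧ ∀ i ∈ S, U.col i = p i := by
  choose b hbE hbO hbS using h.exists_orthonormal_eigenvectors hS hp hp1
  let U : Matrix (Fin n) (Fin n) ℝ := of fun i j => b (d j) ⟨j, rfl⟩ i
  have hU : ∀ μ j (hj : d j = μ), U.col j = b μ ⟨j, hj⟩ := by
    rintro μ j rfl; rfl
  have hUE : ∀ j, A *ᵥ U.col j = d j • U.col j := by
    intro j
    rw [hU _ j rfl]
    exact mem_eigenspaceOf_iff.mp (hbE _ _)
  have hUU : Uᵀ * U = 1 := by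
    ext i j
    rw [one_apply]
    change U.col i ⬝ᵥ U.col j = _
    by_cases hij : d i = d j
    · rw [hU (d j) i hij, hU (d j) j rfl, hbO]
      simp
    · have hne : i ≠ j := fun h => hij (h ▸ rfl)
      rw [if_neg hne]
      have h1 : U.col i ⬝ᵥ (A *ᵥ U.col j) = d i * (U.col i ⬝ᵥ U.col j) := by
        rw [dotProduct_mulVec, ← mulVec_transpose, h.isSymm, hUE, smul_dotProduct, smul_eq_mul]
      rw [hUE, dotProduct_smul, smul_eq_mul] at h1
      have h2 : (d i - d j) * (U.col i ⬝ᵥ U.col j) = 0 := by linarith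
      exact (mul_eq_zero.mp h2).resolve_left (sub_ne_zero.mpr hij)
  have hUU' : U * Uᵀ = 1 := mul_eq_one_comm.mp hUU
  refine ⟨U, ⟨?_, ?_⟩, fun i hi => ?_⟩
  · rw [mem_orthogonalGroup_iff, hUU']
  · have h1 : A * U = U * diagonal d := by
      ext j i
      rw [mul_diagonal, mul_comm]
      exact congrFun (hUE i) j
    rw [← h1, mul_assoc, hUU', mul_one]
  · rw [hU _ i rfl]
    exact hbS _ _ hi

end IsOrthogonalDiagonalization

end Matrix

namespace IsAdaptedDecomposition

variable {n : ℕ} {A : Matrix (Fin n) (Fin n) ℝ} {x d : Fin n → ℝ} {P : Matrix (Fin n) (Fin n) ℝ}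
  {S : Finset (Fin n)}

theorem isOrthogonalDiagonalization (h : IsAdaptedDecomposition A x d P S) :
    A.IsOrthogonalDiagonalization d P :=
  ⟨h.orthogonal, h.eq_mul⟩

end IsAdaptedDecomposition

namespace Matrix.IsOrthogonalDiagonalization

variable {n : ℕ} {A : Matrix (Fin n) (Fin n) ℝ} {x d : Fin n → ℝ} {P : Matrix (Fin n) (Fin n) ℝ}
  {S : Finset (Fin n)}

theorem dotProduct_eq_sum (h : A.IsOrthogonalDiagonalization d P) (x v : Fin n → ℝ) :
    x ⬝ᵥ v = ∑ i, (P.col i ⬝ᵥ v) * (x ⬝ᵥ P.col i) := by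
  nth_rewrite 1 [← h.sum_col v]
  rw [dotProduct_sum]
  simp [dotProduct_smul]

theorem mainEigenvalues_eq_image (h : A.IsOrthogonalDiagonalization d P)
    (hmem : ∀ i ∈ S, x ⬝ᵥ P.col i ≠ 0) (hnot : ∀ i, i ∉ S → x ⬝ᵥ P.col i = 0) :
    mainEigenvalues A x = d '' S := by
  ext μ
  constructor
  · rintro ⟨v, hv, hxv⟩
    rw [h.dotProduct_eq_sum] at hxv
    obtain ⟨i, -, hi⟩ := Finset.exists_ne_zero_of_sum_ne_zero hxv
    refine ⟨i, ?_, ?_⟩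
    · by_contra hiS
      exact hi (by rw [hnot i hiS, mul_zero])
    · by_contra hd
      exact hi (by rw [h.col_dotProduct_eq_zero hv hd, zero_mul])
  · rintro ⟨i, hi, rfl⟩
    exact ⟨P.col i, h.col_mem_eigenspaceOf i, hmem i hi⟩

end Matrix.IsOrthogonalDiagonalization

namespace IsAdaptedDecomposition

variable {n : ℕ} {A B : Matrix (Fin n) (Fin n) ℝ} {x d : Fin n → ℝ}
  {P U : Matrix (Fin n) (Fin n) ℝ} {S : Finset (Fin n)}

theorem injOn (h : IsAdaptedDecomposition A x d P S) : Set.InjOn d S := by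
  have h1 := h.card_eq
  rw [h.isOrthogonalDiagonalization.mainEigenvalues_eq_image h.mem h.not_mem,
    ← Finset.coe_image, Set.ncard_coe_finset] at h1
  exact Finset.card_image_iff.mp h1.symm

theorem aeval_basis_mulVec (h : IsAdaptedDecomposition A x d P S) {i : Fin n} (hi : i ∈ S) :
    aeval A (Lagrange.basis S d i) *ᵥ x = (x ⬝ᵥ P.col i) • P.col i := by
  rw [h.isOrthogonalDiagonalization.aeval_mulVec, Finset.sum_eq_single i]
  · rw [Lagrange.eval_basis_self h.injOn hi, one_mul, dotProduct_comm]
  · intro j _ hj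
    by_cases hjS : j ∈ S
    · rw [Lagrange.eval_basis_of_ne hj.symm hjS, zero_mul, zero_smul]
    · rw [dotProduct_comm, h.not_mem j hjS, mul_zero, zero_smul]
  · simp

/-- If all polynomials in `A` and in `B` act on `x` in the same way, the columns of adapted
decompositions that are not orthogonal to `x` agree up to sign. -/
theorem col_eq_or_eq_neg (hA : IsAdaptedDecomposition A x d P S)
    (hB : IsAdaptedDecomposition B x d U S) (hAB : ∀ q : ℝ[X], aeval A q *ᵥ x = aeval B q *ᵥ x)
    {i : Fin n} (hi : i ∈ S) : P.col i = U.col i ∨ P.col i = -U.col i := by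
  have h1 : (x ⬝ᵥ P.col i) • P.col i = (x ⬝ᵥ U.col i) • U.col i := by
    rw [← hA.aeval_basis_mulVec hi, ← hB.aeval_basis_mulVec hi, hAB]
  have h2 : (x ⬝ᵥ P.col i) ^ 2 = (x ⬝ᵥ U.col i) ^ 2 := by
    have := congrArg (fun v => x ⬝ᵥ v) h1
    simpa [dotProduct_smul, pow_two] using this
  have h0 := hA.mem i hi
  rcases sq_eq_sq_iff_eq_or_eq_neg.mp h2 with h3 | h3
  · left
    rw [← h3] at h1
    exact smul_right_injective _ h0 h1
  · right
    rw [neg_eq_iff_eq_neg.mp h3.symm, neg_smul, ← smul_neg] at h1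
    exact smul_right_injective _ h0 h1

end IsAdaptedDecomposition

/-- The component of `x` in the eigenspace of `A` for `μ`, where `d` lists the eigenvalues of
`A`. -/
noncomputable def eigenComponent {n : ℕ} (A : Matrix (Fin n) (Fin n) ℝ) (d x : Fin n → ℝ) (μ : ℝ) :
    Fin n → ℝ :=
  aeval A (Lagrange.basis (Finset.univ.image d) id μ) *ᵥ x

namespace Matrix.IsOrthogonalDiagonalization

variable {n : ℕ} {A : Matrix (Fin n) (Fin n) ℝ} {d : Fin n → ℝ} {P : Matrix (Fin n) (Fin n) ℝ}

theorem eval_basis_image (d : Fin n → ℝ) (μ : ℝ) (i : Fin n) :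
    (Lagrange.basis (Finset.univ.image d) id μ).eval (d i) = if d i = μ then 1 else 0 := by
  have hi : d i ∈ Finset.univ.image d := Finset.mem_image_of_mem d (Finset.mem_univ i)
  split_ifs with h
  · subst h
    exact Lagrange.eval_basis_self Function.injective_id.injOn hi
  · exact Lagrange.eval_basis_of_ne (v := id) (Ne.symm h) hi

theorem eigenComponent_eq_sum (h : A.IsOrthogonalDiagonalization d P) (x : Fin n → ℝ) (μ : ℝ) :
    eigenComponent A d x μ = ∑ i, if d i = μ then (P.col i ⬝ᵥ x) • P.col i else 0 := by
  rw [eigenComponent, h.aeval_mulVec]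
  refine Finset.sum_congr rfl fun i _ => ?_
  rw [eval_basis_image]
  split_ifs <;> simp

theorem eigenComponent_mem (h : A.IsOrthogonalDiagonalization d P) (x : Fin n → ℝ) (μ : ℝ) :
    eigenComponent A d x μ ∈ eigenspaceOf A μ := by
  rw [h.eigenComponent_eq_sum]
  refine Submodule.sum_mem _ fun i _ => ?_
  split_ifs with hi
  · subst hi
    exact Submodule.smul_mem _ _ (h.col_mem_eigenspaceOf i)
  · exact Submodule.zero_mem _

theorem eigenComponent_dotProduct (h : A.IsOrthogonalDiagonalization d P) (x : Fin n → ℝ) {μ : ℝ}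
    {v : Fin n → ℝ} (hv : v ∈ eigenspaceOf A μ) : eigenComponent A d x μ ⬝ᵥ v = x ⬝ᵥ v := by
  rw [h.eigenComponent_eq_sum, sum_dotProduct, h.dotProduct_eq_sum x v]
  refine Finset.sum_congr rfl fun i _ => ?_
  split_ifs with hi
  · rw [smul_dotProduct, smul_eq_mul, dotProduct_comm (P.col i) x, mul_comm]
  · rw [h.col_dotProduct_eq_zero hv hi]; simp

/-- The indices that are the first ones of an eigenvalue whose eigenspace is not orthogonal to
`x`. -/
noncomputable def mainIndices (A : Matrix (Fin n) (Fin n) ℝ) (d x : Fin n → ℝ) :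
    Finset (Fin n) := by
  classical
  exact {i | eigenComponent A d x (d i) ≠ 0 ∧ ∀ j, d j = d i → i ≤ j}

theorem mem_mainIndices {x : Fin n → ℝ} {i : Fin n} : i ∈ mainIndices A d x ↔
    eigenComponent A d x (d i) ≠ 0 ∧ ∀ j, d j = d i → i ≤ j := by
  simp [mainIndices]

theorem injOn_mainIndices (A : Matrix (Fin n) (Fin n) ℝ) (d x : Fin n → ℝ) :
    Set.InjOn d (mainIndices A d x) := by
  intro i hi j hj hij
  rw [Finset.mem_coe, mem_mainIndices] at hi hj
  exact le_antisymm (hi.2 j hij.symm) (hj.2 i hij)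

theorem exists_isAdaptedDecomposition (h : A.IsOrthogonalDiagonalization d P) (hd : Antitone d)
    (x : Fin n → ℝ) :
    ∃ U, IsAdaptedDecomposition A x d U (mainIndices A d x) := by
  let w := eigenComponent A d x
  let p : Fin n → Fin n → ℝ := fun i => (√(w (d i) ⬝ᵥ w (d i)))⁻¹ • w (d i)
  have hw : ∀ i ∈ mainIndices A d x, 0 < w (d i) ⬝ᵥ w (d i) := fun i hi =>
    lt_of_le_of_ne (Finset.sum_nonneg fun j _ => mul_self_nonneg _)
      (Ne.symm fun h0 => (mem_mainIndices.mp hi).1 (dotProduct_self_eq_zero.mp h0))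
  obtain ⟨U, hU, hUp⟩ := h.exists_extension (injOn_mainIndices A d x) (p := p)
    (fun i _ => Submodule.smul_mem _ _ (h.eigenComponent_mem x (d i)))
    (fun i hi => by
      have h1 := Real.mul_self_sqrt (hw i hi).le
      have h2 := Real.sqrt_pos.mpr (hw i hi)
      simp only [p, smul_dotProduct, dotProduct_smul, smul_eq_mul]
      field_simp
      rw [pow_two, h1])
  have hxU : ∀ i, x ⬝ᵥ U.col i = w (d i) ⬝ᵥ U.col i := fun i =>
    (h.eigenComponent_dotProduct x (hU.col_mem_eigenspaceOf i)).symm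
  have hmem : ∀ i ∈ mainIndices A d x, x ⬝ᵥ U.col i ≠ 0 := by
    intro i hi
    rw [hxU, hUp i hi, dotProduct_smul, smul_eq_mul]
    exact mul_ne_zero (inv_ne_zero (Real.sqrt_pos.mpr (hw i hi)).ne') (hw i hi).ne'
  have hnot : ∀ i, i ∉ mainIndices A d x → x ⬝ᵥ U.col i = 0 := by
    intro i hi
    rw [hxU]
    by_cases hwi : w (d i) = 0
    · rw [hwi, zero_dotProduct]
    · let T : Finset (Fin n) := {j | d j = d i}
      have hT : T.Nonempty := ⟨i, by simp [T]⟩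
      let k := T.min' hT
      have hk : d k = d i := by
        have := T.min'_mem hT
        simpa [T] using this
      have hkS : k ∈ mainIndices A d x := by
        refine mem_mainIndices.mpr ⟨hk ▸ hwi, fun j hj => T.min'_le j ?_⟩
        simpa [T] using hj.trans hk
      have hki : k ≠ i := fun h => hi (h ▸ hkS)
      have h1 := hU.col_dotProduct_col k i
      rw [if_neg hki, hUp k hkS, smul_dotProduct, smul_eq_mul, hk] at h1
      refine (mul_eq_zero.mp h1).resolve_left (inv_ne_zero ?_)
      rw [← hk]
      exact (Real.sqrt_pos.mpr (hw k hkS)).ne'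
  refine ⟨U, hd, hU.orthogonal, hU.eq_mul, ?_, hmem, hnot⟩
  rw [hU.mainEigenvalues_eq_image hmem hnot, ← Finset.coe_image, Set.ncard_coe_finset]
  exact (Finset.card_image_iff.mpr (injOn_mainIndices A d x)).symm

end Matrix.IsOrthogonalDiagonalization

theorem mainTheorem4 (n : ℕ) (hn : 3 ≤ n) (A B : Matrix (Fin n) (Fin n) ℝ)
    (hA : A.IsSymm) (hB : B.IsSymm) (hAB : Hypomorphic A B) :
    (∃ (S : Finset (Fin n)) (d : Fin n → ℝ) (P U : Matrix (Fin n) (Fin n) ℝ),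
      IsAdaptedDecomposition A 1 d P S ∧ IsAdaptedDecomposition B 1 d U S ∧
      ∀ i ∈ S, P.col i = U.col i ∨ P.col i = -U.col i) ∧
    (∀ (S : Finset (Fin n)) (d : Fin n → ℝ) (P U : Matrix (Fin n) (Fin n) ℝ),
      IsAdaptedDecomposition A 1 d P S → IsAdaptedDecomposition B 1 d U S →
      ∀ i ∈ S, P.col i = U.col i ∨ P.col i = -U.col i) ∧
    (∀ μ : ℝ, Module.finrank ℝ (eigenspaceOf A μ) = 1 →
      (∃ v ∈ eigenspaceOf A μ, (1 : Fin n → ℝ) ⬝ᵥ v ≠ 0) →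
      eigenspaceOf A μ = eigenspaceOf B μ) := by
  have hpoly := hAB.aeval_mulVec_one_eq hn hA hB
  have hA' : A.IsHermitian := isHermitian_iff_isSymm.mpr hA
  have hB' : B.IsHermitian := isHermitian_iff_isSymm.mpr hB
  have heig : hA'.eigenvalues = hB'.eigenvalues :=
    (hA'.eigenvalues_eq_eigenvalues_iff hB').mpr (hAB.charpoly_eq_and_adjugateOnes_eq hn hA hB).1
  obtain ⟨τ, hd⟩ := hA'.exists_perm_antitone_eigenvalues
  obtain ⟨P, hP⟩ := hA'.exists_isOrthogonalDiagonalization τ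
  obtain ⟨U, hU⟩ := hB'.exists_isOrthogonalDiagonalization τ
  rw [← heig] at hU
  generalize hA'.eigenvalues ∘ τ = d at hd hP hU
  have hcomp : ∀ μ, eigenComponent A d 1 μ = eigenComponent B d 1 μ := fun μ => hpoly _
  refine ⟨?_, ?_, ?_⟩
  · obtain ⟨P', hP'⟩ := hP.exists_isAdaptedDecomposition hd 1
    obtain ⟨U', hU'⟩ := hU.exists_isAdaptedDecomposition hd 1
    have hS : IsOrthogonalDiagonalization.mainIndices B d 1 =
        IsOrthogonalDiagonalization.mainIndices A d 1 := by
      ext i; simp only [IsOrthogonalDiagonalization.mem_mainIndices, hcomp]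
    rw [hS] at hU'
    exact ⟨_, d, P', U', hP', hU', fun i hi => hP'.col_eq_or_eq_neg hU' hpoly hi⟩
  · exact fun S d P U hP hU i hi => hP.col_eq_or_eq_neg hU hpoly hi
  · rintro μ hμ ⟨v, hv, h1v⟩
    have hw0 : eigenComponent A d 1 μ ≠ 0 := by
      intro h0
      rw [← hP.eigenComponent_dotProduct 1 hv, h0, zero_dotProduct] at h1v
      exact h1v rfl
    have hμB : Module.finrank ℝ (eigenspaceOf B μ) = 1 := by
      rw [hU.finrank_eigenspaceOf, ← hP.finrank_eigenspaceOf, hμ]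
    have hspan : ∀ M : Matrix (Fin n) (Fin n) ℝ, Module.finrank ℝ (eigenspaceOf M μ) = 1 →
        eigenComponent A d 1 μ ∈ eigenspaceOf M μ →
        Submodule.span ℝ {eigenComponent A d 1 μ} = eigenspaceOf M μ := by
      intro M hM hmem
      refine Submodule.eq_of_le_of_finrank_eq ?_ ?_
      · rwa [Submodule.span_singleton_le_iff_mem]
      · rw [finrank_span_singleton hw0, hM]
    rw [← hspan A hμ (hP.eigenComponent_mem 1 μ),
      ← hspan B hμB (hcomp μ ▸ hU.eigenComponent_mem 1 μ)]
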